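/- Let $\alpha\in[-1,1]\setminus\{0\}$, let $j_*\ge 1$ and $k\ge 2j_*-1$ be integers, and let $p:\mathbb R\to\mathbb R$ be an even $C^2$ function, strictly monotone on $[0,\infty)$, such that $|p(\xi)|\eqsim|\xi|^{\alpha}$, $|p'(\xi)|\eqsim|\xi|^{\alpha-1}$ and $|p''(\xi)|\lesssim|\xi|^{\alpha-2}$ for $|\xi|\gg1$, and such that near the origin $p(\xi)=p(0)+\xi^{2j_*}\tilde p(\xi)$ with $\tilde p$ locally Lipschitz and $\tilde p(0)\ne0$. Put $$m(a,b)=\frac{a+b}{2\,[\,p(a)a+p(b)b-p(a+b)(a+b)\,]},\qquad N(\xi,\eta,\sigma)=\frac{m(\xi-\eta,\eta)}{\xi}-\frac{m(\xi-\eta,\sigma)}{\xi-\eta+\sigma}.$$ Let $\mathcal A_{2,+}^c$ be the set of $(\xi,\eta,\sigma)\in[1,\infty)^3$ such that $|z_1-z_2|+|z_2-z_3|\le\frac1{10}|z_2|$ for every rearrangement $(z_1,z_2,z_3)$ of $(\xi,\eta,\sigma)$. Let $\mathcal B$ be the set of $(\xi,\eta,\sigma)\in\mathbb R^3$ with $\xi,\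 \xi-\eta+\sigma,\ \sigma\ge1$ and $$|\sigma-\eta|+|\xi-\sigma|\le\tfrac1{10}\xi,\quad |\xi-\eta|+|\sigma-\xi|\le\tfrac1{10}\sigma,\quad |\eta-\sigma|+|\xi-\eta|\le\tfrac1{10}(\xi-\eta+\sigma).$$ For real-valued $u$ with Fourier transform $\hat u(\xi)=\int u(x)e^{-ix\xi}\,dx$, the main commutator is $$[\mathcal A_{2,+}^c\cap\mathcal B](\tilde F_{1,0}+\tilde G_{1,0})=-\mathrm i\int_{\mathcal A_{2,+}^c\cap\mathcal B}N(\xi,\eta,\sigma)\,(\xi-\eta)\,\sigma^k\xi^{k+1}\,\hat u(\xi-\eta)\hat u(\eta-\sigma)\hat u(\sigma)\overline{\hat u(\xi)}\,d\xi\,d\eta\,d\sigma .$$ Then there is a constant $C$, depending only on $p$, $\alpha$, $j_*$ and $k$, such that the following hold. (i) The symbol gains two derivatives: for all $(\xi,\eta,\sigma)\in\mathcal A_{2,+}^c\cap\mathcal B$ (a quotient with zero denominator being read as $0$, which matters only on the null set $\xi=\eta$), $$|N(\xi,\eta,\sigma)|\le C\,\Big|\frac{m(\xi-\eta,\eta)}{\xi}\Big|\,\Big|\frac{m(\xi-\eta,\sigma)}{\xi-\eta+\sigma}\Big|\;|\xi-\eta|\,|\sigma-\eta|\,\eta^{\alpha-1}.$$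 (ii) For every real-valued $u\in H^2(\mathbb R)\cap H^k(\mathbb R)$ the integral defining the main commutator converges absolutely, and $$\big|[\mathcal A_{2,+}^c\cap\mathcal B](\tilde F_{1,0}+\tilde G_{1,0})\big|\le C\,\|u\|_{H^1}\|u\|_{H^2}\|u\|_{H^k}^2 .$$ -/

import Mathlib

open MeasureTheory Filter Topology Asymptotics Set
open scoped FourierTransform

noncomputable section

namespace Whitham

/-- The standing assumptions on the dispersive symbol `p` of a Whitham-type equation of order `α`,
with an extremum of order `2j` at the origin.

Far field: `|p| ≂ |ξ|^α` and `|p'| ≂ |ξ|^(α-1)` as `|ξ| → ∞`. Of the second derivative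
only the upper bound `|p''| ≲ |ξ|^(α-2)` is asked for: it is weaker than `|p''| ≂ |ξ|^(α-2)`, and
for `α = 1` the two-sided version would contradict `|p'| ≂ 1`. -/
structure IsSymbol (α : ℝ) (j : ℕ) (p : ℝ → ℝ) : Prop where
  order_mem : α ∈ Icc (-1 : ℝ) 1
  order_ne_zero : α ≠ 0
  one_le : 1 ≤ j
  contDiff : ContDiff ℝ 2 p
  even : ∀ ξ, p (-ξ) = p ξ
  strictMonotone : StrictMonoOn p (Ici 0) ∨ StrictAntiOn p (Ici 0)
  far_zero : p =Θ[cocompact ℝ] fun ξ => |ξ| ^ α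
  far_one : deriv p =Θ[cocompact ℝ] fun ξ => |ξ| ^ (α - 1)
  far_two : iteratedDeriv 2 p =O[cocompact ℝ] fun ξ => |ξ| ^ (α - 2)
  near_zero : ∃ q : ℝ → ℝ, ∃ δ > 0, LocallyLipschitzOn (Ioo (-δ) δ) q ∧ q 0 ≠ 0 ∧
    ∀ ξ ∈ Ioo (-δ) δ, p ξ = p 0 + ξ ^ (2 * j) * q ξ

/-- The normal form multiplier `m(a,b) = (a+b) / (2 [p(a) a + p(b) b - p(a+b) (a+b)])`. -/
def mult (p : ℝ → ℝ) (a b : ℝ) : ℝ :=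
  (a + b) / (2 * (p a * a + p b * b - p (a + b) * (a + b)))

/-- The Fourier transform `û(ξ) = ∫ u(x) e^{-ixξ} dx` of a real-valued `u ∈ L²(ℝ)`: Mathlib's
`L²` transform has the kernel `e^{-2πixξ}`, hence the rescaling. -/
def uhat (u : Lp ℝ 2 (volume : Measure ℝ)) (ξ : ℝ) : ℂ :=
  (𝓕 (Complex.ofRealCLM.compLp u : Lp ℂ 2 (volume : Measure ℝ)) : Lp ℂ 2 (volume : Measure ℝ))
    (ξ / (2 * Real.pi))

/-- `u ∈ H^s(ℝ)`, for `u ∈ L²(ℝ)`. -/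
def MemH (s : ℕ) (u : Lp ℝ 2 (volume : Measure ℝ)) : Prop :=
  Integrable (fun ξ : ℝ => (1 + ξ ^ 2) ^ s * ‖uhat u ξ‖ ^ 2)

/-- The norm of `H^s(ℝ)`, normalised so that it is the `L²` norm for `s = 0`. -/
def normH (s : ℕ) (u : Lp ℝ 2 (volume : Measure ℝ)) : ℝ :=
  Real.sqrt ((2 * Real.pi)⁻¹ * ∫ ξ : ℝ, (1 + ξ ^ 2) ^ s * ‖uhat u ξ‖ ^ 2)

/-! Regions of the frequency space, whose points are `(ξ, η, σ)`. -/

/-- Low frequencies. -/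
def regA1 : Set (ℝ × ℝ × ℝ) := {(ξ, η, σ) | min |ξ| (min |η| |σ|) < 1}

/-- High frequencies, away from the diagonal; `(z₁, z₂, z₃)` runs through the rearrangements of
`(ξ, η, σ)`. -/
def regA2 : Set (ℝ × ℝ × ℝ) :=
  {(ξ, η, σ) | (ξ, η, σ) ∈ regA1ᶜ ∧ ∃ e : Equiv.Perm (Fin 3),
    let z : Fin 3 → ℝ := fun i => ![ξ, η, σ] (e i)
    1 / 10 * |z 1| < |z 0 - z 1| + |z 1 - z 2|}

/-- The positive part of the high, near-diagonal frequencies, `𝒜₂,₊ᶜ`. -/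
def regA2cPos : Set (ℝ × ℝ × ℝ) :=
  {(ξ, η, σ) | (ξ, η, σ) ∈ regA1ᶜ \ regA2 ∧ 1 ≤ ξ ∧ 1 ≤ η ∧ 1 ≤ σ}

def regB1 : Set (ℝ × ℝ × ℝ) := {(ξ, η, σ) | 1 ≤ ξ ∧ 1 ≤ ξ - η + σ ∧ 1 ≤ σ}

def regB2 : Set (ℝ × ℝ × ℝ) :=
  {(ξ, η, σ) | |σ - η| + |ξ - σ| ≤ 1 / 10 * ξ ∧
    |ξ - η| + |σ - ξ| ≤ 1 / 10 * σ ∧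
    |η - σ| + |ξ - η| ≤ 1 / 10 * (ξ - η + σ)}

def regB : Set (ℝ × ℝ × ℝ) := regB1 ∩ regB2

/-- `N(ξ,η,σ) = m(ξ-η,η)/ξ - m(ξ-η,σ)/(ξ-η+σ)`. -/
def commSymbol (p : ℝ → ℝ) (ξ η σ : ℝ) : ℝ :=
  mult p (ξ - η) η / ξ - mult p (ξ - η) σ / (ξ - η + σ)

/-- The density of `dM(û)`: `û(ξ-η) û(η-σ) û(σ) conj(û(ξ))`. -/
def quarticDensity (u : Lp ℝ 2 (volume : Measure ℝ)) (ξ η σ : ℝ) : ℂ :=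
  uhat u (ξ - η) * uhat u (η - σ) * uhat u σ * (starRingEnd ℂ) (uhat u ξ)

/-- The integrand `[m(ξ-η,σ)/(ξ-η+σ) - m(ξ-η,η)/ξ] (ξ-η) σ^k ξ^(k+1)` times the density of
`dM(û)`; the bracket is `-N`. -/
def commIntegrand (p : ℝ → ℝ) (k : ℕ) (u : Lp ℝ 2 (volume : Measure ℝ)) (z : ℝ × ℝ × ℝ) : ℂ :=
  let ξ := z.1
  let η := z.2.1
  let σ := z.2.2
  ((-commSymbol p ξ η σ * (ξ - η) * σ ^ k * ξ ^ (k + 1) : ℝ) : ℂ) * quarticDensity u ξ η σ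

/-- The main commutator `[𝒜₂,₊ᶜ ∩ ℬ](F̃₁,₀ + G̃₁,₀)`. -/
def mainCommutator (p : ℝ → ℝ) (k : ℕ) (u : Lp ℝ 2 (volume : Measure ℝ)) : ℂ :=
  Complex.I * ∫ z in regA2cPos ∩ regB, commIntegrand p k u z

end Whitham

end

open scoped ENNReal

namespace Whitham

/-! Write `Ω` for the resonance function. Since `m(a,b)/(a+b) = 1/(2Ω(a,b))`, the symbol `N` is a
difference of reciprocals, equal with `a = ξ - η` to `(Ω(a,σ) - Ω(a,η)) / (2 Ω(a,η) Ω(a,σ))`. The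
numerator is, up to sign, a second difference of `x p(x)` with steps `a` and `σ - η`, and `(x p)'' =
x p'' + 2p' = O(x^(α-1))` on `[1/2, ∞)`. This is (i), carried by `exists_resonance_sub_bound`.

For (ii) the denominators must be bounded below. Monotonicity of `p` gives `|Ω(a,b)| ≥ a |p(a+b) -
p(a)|` for `a > 0`, and dyadic increments of `p` at `x` are at least of size `x^α`. The outcome is
`a² b^α ≲ W Ω(a,b)²` with the loss `W = 1 + (1+|a|)²/b` (`exists_resonance_lower`). Hence `|N| |ξ-η|
ξ ≲ |η-σ| (1 + (1+(ξ-η)²)/ξ)`, which leaves `k` derivatives on each of `û(σ)` and `û(ξ)`.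

The term without loss is a convolution form with the kernels `û` and `|x| û` in `L¹`, controlled by
`H¹` and `H²`. The term with loss has the kernels `(1+x²) û` and `|x| û`, which are only used in
`L²`, again controlled by `H²` and `H¹`. Cauchy–Schwarz in `η` uses them up, and the factor `1/ξ`
pays for the remaining integration over `σ`, which is comparable to `ξ`. -/

/-! ### The resonance function: identities and lower bounds -/

/-- The resonance function `p(a) a + p(b) b - p(a+b) (a+b)`. -/
noncomputable def resonance (p : ℝ → ℝ) (a b : ℝ) : ℝ := p a * a + p b * b - p (a + b) * (a + b)

lemma mult_div_add (p : ℝ → ℝ) {a b : ℝ} (h : a + b ≠ 0) :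
    mult p a b / (a + b) = 1 / (2 * resonance p a b) := by
  unfold mult resonance
  rw [div_right_comm, div_self h]

lemma resonance_zero_left (p : ℝ → ℝ) (b : ℝ) : resonance p 0 b = 0 := by
  simp [resonance]

/-- For even `p` the resonance function is the sum of `z p(z)` over the triple `a, b, -(a+b)` of sum
zero. This symmetry trades a negative `a` for a positive one. -/
lemma resonance_neg_left {p : ℝ → ℝ} (he : ∀ ξ, p (-ξ) = p ξ) (a b : ℝ) :
    resonance p a b = -resonance p (-a) (a + b) := by
  simp only [resonance, he]
  rw [neg_add_cancel_left]
  ring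

lemma resonance_neg (p : ℝ → ℝ) (a b : ℝ) :
    resonance (fun x => -p x) a b = -resonance p a b := by
  simp only [resonance]; ring

/-- Here `-Ω(a,b) = a (P(a+b) - P(a)) + b (P(a+b) - P(b))`, and both terms are nonnegative. The
first suffices because `a` is the small frequency, so that its increment is the large one. -/
lemma resonance_le_of_monotone {P : ℝ → ℝ} (hP : StrictMonoOn P (Ici 0)) {a b : ℝ}
    (ha : 0 < a) (hb : 0 < b) : a * (P (a + b) - P a) ≤ -resonance P a b := by
  have h := hP.monotoneOn (mem_Ici.2 hb.le) (mem_Ici.2 (add_pos ha hb).le)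
    (le_add_of_nonneg_left ha.le)
  have : 0 ≤ b * (P (a + b) - P b) := mul_nonneg hb.le (sub_nonneg.2 h)
  simp only [resonance]
  nlinarith

lemma rpow_le_two_mul {α x y : ℝ} (hα : α ∈ Icc (-1 : ℝ) 1) (hx : 0 < x)
    (h1 : y ≤ 2 * x) (h2 : x ≤ 2 * y) : y ^ α ≤ 2 * x ^ α := by
  have hy : 0 < y := by linarith
  rcases le_total 0 α with h | h
  · calc y ^ α ≤ (2 * x) ^ α := Real.rpow_le_rpow hy.le h1 h
      _ = 2 ^ α * x ^ α := Real.mul_rpow (by norm_num) hx.le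
      _ ≤ 2 * x ^ α := by
        gcongr
        simpa using Real.rpow_le_rpow_of_exponent_le (by norm_num : (1 : ℝ) ≤ 2) hα.2
  · calc y ^ α ≤ (x / 2) ^ α := Real.rpow_le_rpow_of_nonpos (by positivity) (by linarith) h
      _ = x ^ α * 2 ^ (-α) := by
        rw [Real.div_rpow hx.le (by norm_num), Real.rpow_neg (by norm_num), div_eq_mul_inv]
      _ ≤ x ^ α * 2 := by
        gcongr
        simpa using Real.rpow_le_rpow_of_exponent_le (by norm_num : (1 : ℝ) ≤ 2)
          (by linarith [hα.1] : -α ≤ 1)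
      _ = _ := mul_comm _ _

/-- Dyadic increments of a strictly increasing function with `|P'| ≳ x^(α-1)` at infinity. -/
lemma exists_dyadic_lower {P : ℝ → ℝ} {α : ℝ} (hα : α ∈ Icc (-1 : ℝ) 1)
    (hd : Differentiable ℝ P) (hP : StrictMonoOn P (Ici 0))
    (hfar : (fun x : ℝ => |x| ^ (α - 1)) =O[atTop] deriv P) :
    ∃ c > 0, ∀ x : ℝ, 1 / 10 ≤ x → c * x ^ α ≤ P (2 * x) - P x := by
  obtain ⟨K, hK, hb⟩ := hfar.exists_pos
  obtain ⟨R, hR⟩ := eventually_atTop.1 (hb.bound)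
  set S := max R 1
  -- On `[1/10, S]` the quotient is continuous and positive, so its minimum is a valid constant;
  -- beyond `S` the mean value theorem takes over.
  have hcont : ContinuousOn (fun x => (P (2 * x) - P x) / x ^ α) (Icc (1 / 10) S) := by
    refine ContinuousOn.div ?_ ?_ ?_
    · have := hd.continuous
      fun_prop
    · exact fun x hx => (Real.continuousAt_rpow_const x α
        (Or.inl (by linarith [hx.1]))).continuousWithinAt
    · exact fun x hx => (Real.rpow_pos_of_pos (by linarith [hx.1]) _).ne'
  obtain ⟨x₀, hx₀, hmin⟩ := isCompact_Icc.exists_isMinOn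
    (⟨1 / 10, le_refl _, le_trans (by norm_num) (le_max_right R 1)⟩ :
      (Icc (1 / 10 : ℝ) S).Nonempty) hcont
  have hx0 : 0 < x₀ := by linarith [hx₀.1]
  have hc0 : 0 < (P (2 * x₀) - P x₀) / x₀ ^ α := by
    refine div_pos (sub_pos.2 (hP ?_ ?_ ?_)) (Real.rpow_pos_of_pos hx0 _)
    · exact hx0.le
    · exact (by linarith : (0:ℝ) ≤ 2 * x₀)
    · linarith
  refine ⟨min ((P (2 * x₀) - P x₀) / x₀ ^ α) (K⁻¹ / 4), lt_min hc0 (by positivity), ?_⟩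
  intro x hx
  have hx' : 0 < x := by linarith
  have hxα : 0 < x ^ α := Real.rpow_pos_of_pos hx' _
  by_cases hxS : x ≤ S
  · refine le_trans (mul_le_mul_of_nonneg_right (min_le_left _ _) hxα.le) ?_
    exact (le_div_iff₀ hxα).1 (hmin (⟨hx, hxS⟩ : x ∈ Icc (1 / 10) S))
  · refine le_trans (mul_le_mul_of_nonneg_right (min_le_right _ _) hxα.le) ?_
    push Not at hxS
    obtain ⟨y, hy, hyd⟩ := exists_deriv_eq_slope P (by linarith : x < 2 * x)
      hd.continuous.continuousOn hd.differentiableOn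
    have hy0 : 0 < y := by linarith [hy.1]
    have hyR : R ≤ y := by linarith [hy.1, le_max_left R 1]
    have h1 := hR y hyR
    have hpos : 0 ≤ deriv P y := by
      rw [hyd]
      refine div_nonneg (sub_nonneg.2 (hP.monotoneOn ?_ ?_ ?_)) (by linarith)
      · exact hx'.le
      · exact (by linarith : (0:ℝ) ≤ 2 * x)
      · linarith
    rw [Real.norm_eq_abs, Real.norm_eq_abs, abs_of_nonneg hpos, abs_of_pos hy0,
      abs_of_nonneg (Real.rpow_nonneg hy0.le _)] at h1
    have h2 : P (2 * x) - P x = deriv P y * x := by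
      rw [hyd]; field_simp; ring
    -- The power decreases because `α ≤ 1`. One factor 2 is lost in `(2x)^(α-1) x = (2x)^α / 2` and
    -- another in comparing `x^α` with `(2x)^α`, whence the constant `K⁻¹ / 4`.
    have h3 : (2 * x) ^ (α - 1) ≤ y ^ (α - 1) :=
      Real.rpow_le_rpow_of_nonpos hy0 hy.2.le (by linarith [hα.2])
    have h4 : (2 * x) ^ (α - 1) * (2 * x) = (2 * x) ^ α := by
      rw [← Real.rpow_add_one (by positivity)]; ring_nf
    have h5 : x ^ α ≤ 2 * (2 * x) ^ α :=
      rpow_le_two_mul hα (by positivity) (by linarith) (by linarith)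
    have h6 : x ^ α ≤ 4 * (K * deriv P y * x) := by
      have : (2 * x) ^ (α - 1) * x ≤ K * deriv P y * x := by gcongr; exact h3.trans h1
      linarith
    rw [h2]
    calc K⁻¹ / 4 * x ^ α ≤ K⁻¹ / 4 * (4 * (K * deriv P y * x)) := by gcongr
      _ = _ := by field_simp

/-- The weight that measures the failure of the resonance function to be of size `|a| b^(α/2)`. -/
noncomputable def lossWeight (a b : ℝ) : ℝ := 1 + (1 + |a|) ^ 2 / b

lemma one_le_lossWeight (a : ℝ) {b : ℝ} (hb : 0 < b) : 1 ≤ lossWeight a b := by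
  unfold lossWeight
  have : 0 ≤ (1 + |a|) ^ 2 / b := by positivity
  linarith

/-- For `α ≥ 0` the increment is already seen on `[b/2, b]`, and no loss occurs. For `α < 0` the
function flattens at infinity, so the increment comes from the frequencies near `a`; its size
`(1+a)^α` may fall below `b^(α/2)`, and `lossWeight` makes up for this. -/
lemma exists_sq_sub_lower {P : ℝ → ℝ} {α : ℝ} (hα : α ∈ Icc (-1 : ℝ) 1)
    (hd : Differentiable ℝ P) (hP : StrictMonoOn P (Ici 0))
    (hfar : (fun x : ℝ => |x| ^ (α - 1)) =O[atTop] deriv P) :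
    ∃ c > 0, ∀ a b : ℝ, 0 < a → a ≤ b / 10 → 1 ≤ b →
      c * b ^ α ≤ lossWeight a b * (P (a + b) - P a) ^ 2 := by
  obtain ⟨c, hc, h⟩ := exists_dyadic_lower hα hd hP hfar
  have mono : ∀ {x y : ℝ}, 0 ≤ x → x ≤ y → P x ≤ P y := fun hx hxy =>
    hP.monotoneOn hx (hx.trans hxy) hxy
  refine ⟨c ^ 2 / 4, by positivity, fun a b ha hab hb => ?_⟩
  have hw := one_le_lossWeight a (by linarith : 0 < b)
  have hb0 : 0 < b := by linarith
  rcases le_total 0 α with h0 | h0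
  · have h1 := h (b / 2) (by linarith)
    rw [mul_div_cancel₀ b (by norm_num : (2 : ℝ) ≠ 0)] at h1
    have h2 : P b - P (b / 2) ≤ P (a + b) - P a := by
      have := mono hb0.le (by linarith : b ≤ a + b)
      have := mono ha.le (by linarith : a ≤ b / 2)
      linarith
    have h3 : b ^ α ≤ 2 * (b / 2) ^ α :=
      rpow_le_two_mul hα (by positivity) (by linarith) (by linarith)
    have h4 : c / 2 * b ^ α ≤ P (a + b) - P a := by nlinarith
    -- Squaring the increment gives `b^(2α)`, more than the required `b^α` since `b ≥ 1` and `α ≥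
    -- 0`.
    have h5 : (1 : ℝ) ≤ b ^ α := Real.one_le_rpow hb h0
    calc c ^ 2 / 4 * b ^ α ≤ c ^ 2 / 4 * (b ^ α * b ^ α) := by gcongr; nlinarith
      _ = (c / 2 * b ^ α) ^ 2 := by ring
      _ ≤ (P (a + b) - P a) ^ 2 := by gcongr
      _ ≤ _ := le_mul_of_one_le_left (sq_nonneg _) hw
  -- The dyadic bound is only available away from the origin, so `a` is raised to at least `1/10`;
  -- as `b ≥ 1` and `a ≤ b/10`, the interval `[a', 2a']` still lies in `[a, a+b]`.
  · set a' := max a (1 / 10)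
    have ha1 : a ≤ a' := le_max_left _ _
    have ha2 : 1 / 10 ≤ a' := le_max_right _ _
    have ha3 : a' ≤ 1 + a := max_le (by linarith) (by linarith)
    have ha4 : 2 * a' ≤ a + b := by
      have : a' ≤ b / 10 := max_le hab (by linarith)
      linarith
    have h1 := h a' ha2
    have h2 : P (2 * a') - P a' ≤ P (a + b) - P a := by
      have := mono (by linarith) ha4
      have := mono ha.le ha1
      linarith
    have h3 : (1 + a) ^ α ≤ a' ^ α := Real.rpow_le_rpow_of_nonpos (by linarith) ha3 h0
    have h4 : c * (1 + a) ^ α ≤ P (a + b) - P a := by nlinarith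
    have h5 : 0 < (1 + a) ^ α := Real.rpow_pos_of_pos (by linarith) _
    have h6 : b ^ α ≤ lossWeight a b * ((1 + a) ^ α) ^ 2 := by
      -- The claim reads `t^(-α) ≤ 1 + t`, which holds because `0 ≤ -α ≤ 1`.
      set t := (1 + a) ^ 2 / b with ht
      have ht0 : 0 < t := by positivity
      have e1 : t ^ (-α) = b ^ α / ((1 + a) ^ α) ^ 2 := by
        rw [ht, Real.div_rpow (by positivity) hb0.le, Real.rpow_neg hb0.le,
          Real.rpow_neg (by positivity), ← Real.rpow_natCast, ← Real.rpow_mul (by positivity),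
          ← Real.rpow_natCast, ← Real.rpow_mul (by positivity), mul_comm α]
        field_simp
      have e2 : t ^ (-α) ≤ 1 + t := by
        rcases le_total t 1 with h | h
        · linarith [Real.rpow_le_one ht0.le h (by linarith : 0 ≤ -α)]
        · have := Real.rpow_le_rpow_of_exponent_le h (by linarith [hα.1] : -α ≤ 1)
          rw [Real.rpow_one] at this
          linarith
      rw [e1, div_le_iff₀ (by positivity)] at e2
      simpa [lossWeight, abs_of_pos ha, ht] using e2
    calc c ^ 2 / 4 * b ^ α ≤ c ^ 2 * b ^ α := by
          have : 0 ≤ c ^ 2 * b ^ α := by positivity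
          linarith
      _ ≤ c ^ 2 * (lossWeight a b * ((1 + a) ^ α) ^ 2) := by gcongr
      _ = lossWeight a b * (c * (1 + a) ^ α) ^ 2 := by ring
      _ ≤ _ := by gcongr

lemma exists_resonance_lower_of_pos {P : ℝ → ℝ} {α : ℝ} (hα : α ∈ Icc (-1 : ℝ) 1)
    (hd : Differentiable ℝ P) (hP : StrictMonoOn P (Ici 0))
    (hfar : (fun x : ℝ => |x| ^ (α - 1)) =O[atTop] deriv P) :
    ∃ c > 0, ∀ a b : ℝ, 0 < a → a ≤ b / 10 → 1 ≤ b →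
      c * (a ^ 2 * b ^ α) ≤ lossWeight a b * resonance P a b ^ 2 := by
  obtain ⟨c, hc, h⟩ := exists_sq_sub_lower hα hd hP hfar
  refine ⟨c, hc, fun a b ha hab hb => ?_⟩
  have h1 := resonance_le_of_monotone hP ha (by linarith : 0 < b)
  have h2 : 0 ≤ P (a + b) - P a := sub_nonneg.2 <|
    hP.monotoneOn ha.le (by linarith : (0 : ℝ) ≤ a + b) (by linarith)
  have hw := one_le_lossWeight a (by linarith : 0 < b)
  calc c * (a ^ 2 * b ^ α) = a ^ 2 * (c * b ^ α) := by ring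
    _ ≤ a ^ 2 * (lossWeight a b * (P (a + b) - P a) ^ 2) :=
        mul_le_mul_of_nonneg_left (h a b ha hab hb) (sq_nonneg a)
    _ = lossWeight a b * (a * (P (a + b) - P a)) ^ 2 := by ring
    _ ≤ lossWeight a b * (-resonance P a b) ^ 2 := by gcongr
    _ = _ := by rw [neg_sq]

namespace IsSymbol

variable {α : ℝ} {j : ℕ} {p : ℝ → ℝ}

/-- The bound is stated in terms of `η` comparable to `b`, so that `Ω(a,η)` and `Ω(a,σ)` are
measured against the same weight. A decreasing `p` is replaced by `-p`. A negative `a` is replaced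
by `-a`, with `a + b` in place of `b`; this is why `|a|` is assumed small against both. -/
lemma exists_resonance_lower (hp : IsSymbol α j p) :
    ∃ c > 0, ∀ a b η : ℝ, a ≠ 0 → |a| ≤ b / 10 → |a| ≤ (a + b) / 10 → 1 ≤ b → 1 ≤ a + b →
      |b - η| ≤ η / 10 → c * (a ^ 2 * η ^ α) ≤ lossWeight a η * resonance p a b ^ 2 := by
  have hd : Differentiable ℝ p := hp.contDiff.differentiable (by norm_num)
  have hfar : (fun x : ℝ => |x| ^ (α - 1)) =O[atTop] deriv p :=
    hp.far_one.2.mono atTop_le_cocompact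
  have key : ∃ c > 0, ∀ a b : ℝ, 0 < a → a ≤ b / 10 → 1 ≤ b →
      c * (a ^ 2 * b ^ α) ≤ lossWeight a b * resonance p a b ^ 2 := by
    rcases hp.strictMonotone with hm | hm
    · exact exists_resonance_lower_of_pos hp.order_mem hd hm hfar
    · obtain ⟨c, hc, h⟩ := exists_resonance_lower_of_pos (P := fun x => -p x) hp.order_mem
        hd.neg hm.neg (by simpa [deriv.fun_neg'] using hfar.neg_right)
      refine ⟨c, hc, fun a b ha hab hb => ?_⟩
      simpa [resonance_neg] using h a b ha hab hb
  obtain ⟨c, hc, h⟩ := key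
  -- Passing from `b` to `η` costs a factor 2 in the power and a factor 2 in the weight.
  have step : ∀ a b η : ℝ, 0 < a → a ≤ b / 10 → 1 ≤ b → b ≤ 2 * η → η ≤ 2 * b →
      c / 4 * (a ^ 2 * η ^ α) ≤ lossWeight a η * resonance p a b ^ 2 := by
    intro a b η ha hab hb h1 h2
    have h3 : η ^ α ≤ 2 * b ^ α := rpow_le_two_mul hp.order_mem (by linarith) h2 h1
    have h4 : lossWeight a b ≤ 2 * lossWeight a η := by
      unfold lossWeight
      have hb0 : 0 < b := by linarith
      have hη : 0 < η := by linarith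
      have : (1 + |a|) ^ 2 / b ≤ 2 * ((1 + |a|) ^ 2 / η) := by
        rw [← mul_div_assoc, div_le_div_iff₀ hb0 hη]
        nlinarith [sq_nonneg (1 + |a|)]
      linarith
    have h5 := h a b ha hab hb
    have h6 : a ^ 2 * η ^ α ≤ a ^ 2 * (2 * b ^ α) := by gcongr
    have h7 : lossWeight a b * resonance p a b ^ 2 ≤ 2 * lossWeight a η * resonance p a b ^ 2 := by
      gcongr
    nlinarith
  refine ⟨c / 4, by positivity, fun a b η ha h1 h2 hb hab hη => ?_⟩
  have := abs_le.1 hη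
  have ha1 := abs_le.1 h1
  have ha2 := abs_le.1 h2
  rcases ha.lt_or_gt with h0 | h0
  · have := step (-a) (a + b) η (by linarith) (by linarith) hab (by linarith) (by linarith)
    rw [resonance_neg_left hp.even a b]
    simpa [lossWeight] using this
  · exact step a b η h0 (by linarith) hb (by linarith) (by linarith)

lemma resonance_ne_zero (hp : IsSymbol α j p) {a b : ℝ} (ha : a ≠ 0) (h1 : |a| ≤ b / 10)
    (h2 : |a| ≤ (a + b) / 10) (hb : 1 ≤ b) (hab : 1 ≤ a + b) : resonance p a b ≠ 0 := by
  obtain ⟨c, hc, h⟩ := hp.exists_resonance_lower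
  intro h0
  have := h a b b ha h1 h2 hb hab (by rw [sub_self, abs_zero]; linarith)
  rw [h0] at this
  have hb' : 0 < b ^ α := Real.rpow_pos_of_pos (by linarith) _
  have : 0 < c * (a ^ 2 * b ^ α) := by positivity
  linarith

/-! ### Second differences of `x p(x)` -/

lemma hasDerivAt_id_mul (hp : IsSymbol α j p) (x : ℝ) :
    HasDerivAt (fun x => p x * x) (deriv p x * x + p x) x := by
  have hd : Differentiable ℝ p := hp.contDiff.differentiable (by norm_num)
  simpa using (hd x).hasDerivAt.fun_mul (hasDerivAt_id' x)

lemma hasDerivAt_deriv_id_mul (hp : IsSymbol α j p) (x : ℝ) :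
    HasDerivAt (fun x => deriv p x * x + p x) (iteratedDeriv 2 p x * x + 2 * deriv p x) x := by
  have hd : Differentiable ℝ p := hp.contDiff.differentiable (by norm_num)
  have hd2 : Differentiable ℝ (deriv p) := by
    have : ContDiff ℝ (1 + 1) p := by simpa [one_add_one_eq_two] using hp.contDiff
    exact ((contDiff_succ_iff_deriv.1 this).2.2).differentiable (by norm_num)
  have h := ((hd2 x).hasDerivAt.fun_mul (hasDerivAt_id' x)).fun_add (hd x).hasDerivAt
  rw [iteratedDeriv_succ, iteratedDeriv_one]
  exact h.congr_deriv (by ring)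

/-- The far-field bounds on `p'` and `p''` settle large `x`; compactness settles the rest of `[1/2,
∞)`. -/
lemma exists_second_deriv_bound (hp : IsSymbol α j p) :
    ∃ K > 0, ∀ x : ℝ, 1 / 2 ≤ x →
      |iteratedDeriv 2 p x * x + 2 * deriv p x| ≤ K * x ^ (α - 1) := by
  obtain ⟨K₁, hK₁, h₁⟩ := (hp.far_one.1.mono atTop_le_cocompact).exists_pos
  obtain ⟨K₂, hK₂, h₂⟩ := (hp.far_two.mono atTop_le_cocompact).exists_pos
  obtain ⟨R, hR⟩ := eventually_atTop.1 (h₁.bound.and h₂.bound)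
  have hcont : ContinuousOn (fun x => (iteratedDeriv 2 p x * x + 2 * deriv p x) / x ^ (α - 1))
      (Icc (1 / 2) R) := by
    refine ContinuousOn.div ?_ ?_ ?_
    · have c2 : Continuous (iteratedDeriv 2 p) := hp.contDiff.continuous_iteratedDeriv 2 le_rfl
      have c1 : Continuous (deriv p) := hp.contDiff.continuous_deriv (by norm_num)
      fun_prop
    · exact fun x hx => (Real.continuousAt_rpow_const x _
        (Or.inl (by linarith [hx.1]))).continuousWithinAt
    · exact fun x hx => (Real.rpow_pos_of_pos (by linarith [hx.1]) _).ne'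
  obtain ⟨M, hM⟩ := isCompact_Icc.exists_bound_of_continuousOn hcont
  refine ⟨max M (K₂ + 2 * K₁), lt_max_of_lt_right (by positivity), fun x hx => ?_⟩
  have hx0 : 0 < x := by linarith
  have hxα : 0 < x ^ (α - 1) := Real.rpow_pos_of_pos hx0 _
  rcases le_total x R with h | h
  · have := hM x ⟨hx, h⟩
    rw [norm_div, Real.norm_eq_abs, Real.norm_eq_abs, abs_of_pos hxα, div_le_iff₀ hxα] at this
    exact this.trans (by gcongr; exact le_max_left _ _)
  · obtain ⟨g1, g2⟩ := hR x h
    simp only [Real.norm_eq_abs, abs_of_pos hx0, abs_of_nonneg (Real.rpow_nonneg hx0.le _)] at g1 g2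
    have e : x ^ (α - 2) * x = x ^ (α - 1) := by
      rw [← Real.rpow_add_one hx0.ne']; ring_nf
    calc |iteratedDeriv 2 p x * x + 2 * deriv p x|
        ≤ |iteratedDeriv 2 p x| * x + 2 * |deriv p x| := by
          refine (abs_add_le _ _).trans_eq ?_
          rw [abs_mul, abs_mul, abs_of_pos hx0, abs_of_pos (by norm_num : (0 : ℝ) < 2)]
      _ ≤ K₂ * x ^ (α - 2) * x + 2 * (K₁ * x ^ (α - 1)) := by gcongr
      _ = (K₂ + 2 * K₁) * x ^ (α - 1) := by rw [← e]; ring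
      _ ≤ _ := by gcongr; exact le_max_right _ _

/-- The second difference of `x ↦ x p(x)` at steps `a` and `σ - η`. -/
lemma exists_resonance_sub_bound (hp : IsSymbol α j p) :
    ∃ K > 0, ∀ a η σ : ℝ, 1 ≤ η → |a| ≤ η / 10 → |σ - η| ≤ η / 10 →
      |resonance p a σ - resonance p a η| ≤ K * (|a| * |σ - η| * η ^ (α - 1)) := by
  obtain ⟨K, hK, h⟩ := hp.exists_second_deriv_bound
  refine ⟨K * 4, by positivity, fun a η σ hη ha hσ => ?_⟩
  have hη0 : 0 < η := by linarith
  have ha' := abs_le.1 ha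
  have hσ' := abs_le.1 hσ
  have hy : ∀ y, η / 2 ≤ y →
      |iteratedDeriv 2 p y * y + 2 * deriv p y| ≤ K * 4 * η ^ (α - 1) := by
    intro y hy
    refine (h y (by linarith)).trans ?_
    rw [mul_assoc]
    gcongr
    -- The 4 bounds `2^(1-α)`, as `α ≥ -1`.
    calc y ^ (α - 1) ≤ (η / 2) ^ (α - 1) :=
          Real.rpow_le_rpow_of_nonpos (by positivity) hy (by linarith [hp.order_mem.2])
      _ = 2 ^ (1 - α) * η ^ (α - 1) := by
          rw [Real.div_rpow hη0.le (by norm_num), ← neg_sub α 1, Real.rpow_neg (by norm_num)]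
          field_simp
      _ ≤ 4 * η ^ (α - 1) := by
          gcongr
          calc (2 : ℝ) ^ (1 - α) ≤ 2 ^ (2 : ℝ) :=
                Real.rpow_le_rpow_of_exponent_le (by norm_num) (by linarith [hp.order_mem.1])
            _ = 4 := by norm_num
  -- The mean value inequality is applied twice: to the derivative of `x p(x)` over a step `a`, then
  -- to `x ↦ (x+a) p(x+a) - x p(x)` from `η` to `σ`. All points met exceed `η/2`, since both steps
  -- are at most `η/10`.
  have inner : ∀ x ∈ uIcc η σ, ‖(deriv p (x + a) * (x + a) + p (x + a)) - (deriv p x * x + p x)‖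
      ≤ K * 4 * η ^ (α - 1) * |a| := by
    intro x hx
    have hx' : η - η / 10 ≤ x := by
      rcases mem_uIcc.1 hx with hx | hx <;> linarith [hx.1]
    have := (convex_uIcc x (x + a)).norm_image_sub_le_of_norm_hasDerivWithin_le
      (fun y _ => (hp.hasDerivAt_deriv_id_mul y).hasDerivWithinAt) (C := K * 4 * η ^ (α - 1))
      (fun y hy' => hy y (by rcases mem_uIcc.1 hy' with hy' | hy' <;> linarith [hy'.1]))
      left_mem_uIcc right_mem_uIcc
    simpa using this
  have outer := (convex_uIcc η σ).norm_image_sub_le_of_norm_hasDerivWithin_le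
      (f := fun x => p (x + a) * (x + a) - p x * x)
      (fun y _ => (((hp.hasDerivAt_id_mul (y + a)).comp_add_const y a).fun_sub
        (hp.hasDerivAt_id_mul y)).hasDerivWithinAt) inner
      left_mem_uIcc right_mem_uIcc
  have e : resonance p a σ - resonance p a η =
      -((p (σ + a) * (σ + a) - p σ * σ) - (p (η + a) * (η + a) - p η * η)) := by
    simp only [resonance, add_comm a]; ring
  rw [e, abs_neg]
  refine outer.trans_eq ?_
  rw [Real.norm_eq_abs]; ring

end IsSymbol

/-! ### The commutator symbol on the region -/

/-- The inequalities that a point of `𝒜₂,₊ᶜ ∩ ℬ` satisfies. -/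
lemma bounds_of_mem_region {ξ η σ : ℝ} (h : (ξ, η, σ) ∈ regA2cPos ∩ regB) :
    1 ≤ ξ ∧ 1 ≤ η ∧ 1 ≤ σ ∧ 1 ≤ ξ - η + σ ∧
    |ξ - η| + |η - σ| ≤ η / 10 ∧ |η - ξ| + |ξ - σ| ≤ ξ / 10 ∧
    |ξ - η| + |σ - ξ| ≤ σ / 10 ∧ |η - σ| + |ξ - η| ≤ (ξ - η + σ) / 10 := by
  obtain ⟨⟨⟨h1, h2⟩, hξ, hη, hσ⟩, ⟨-, h3, -⟩, -, h4, h5⟩ := h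
  have hall : ∀ e : Equiv.Perm (Fin 3),
      |![ξ, η, σ] (e 0) - ![ξ, η, σ] (e 1)| + |![ξ, η, σ] (e 1) - ![ξ, η, σ] (e 2)| ≤
        1 / 10 * |![ξ, η, σ] (e 1)| := by
    intro e
    by_contra hcon
    exact h2 ⟨h1, e, not_le.1 hcon⟩
  -- Two rearrangements suffice: the identity has `η` in the middle, the transposition has `ξ`. The
  -- inequalities relative to `σ` and `ξ - η + σ` come from `regB2`.
  have e1 := hall 1
  have e2 := hall (Equiv.swap 0 1)
  rw [Equiv.swap_apply_left, Equiv.swap_apply_right,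
    Equiv.swap_apply_of_ne_of_ne (by decide) (by decide)] at e2
  simp only [Equiv.Perm.coe_one, id_eq, Matrix.cons_val_zero, Matrix.cons_val_one,
    Matrix.cons_val] at e1 e2
  rw [abs_of_nonneg (by linarith : 0 ≤ η)] at e1
  rw [abs_of_nonneg (by linarith : 0 ≤ ξ)] at e2
  refine ⟨hξ, hη, hσ, h3, ?_, ?_, ?_, ?_⟩ <;> linarith

end Whitham

namespace Whitham

lemma commSymbol_eq (p : ℝ → ℝ) {ξ η σ : ℝ} (h1 : ξ ≠ 0) (h2 : ξ - η + σ ≠ 0) :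
    commSymbol p ξ η σ =
      1 / (2 * resonance p (ξ - η) η) - 1 / (2 * resonance p (ξ - η) σ) := by
  have := mult_div_add p (a := ξ - η) (b := η) (by rwa [sub_add_cancel])
  rw [sub_add_cancel] at this
  rw [commSymbol, this, mult_div_add p h2]

namespace IsSymbol

variable {α : ℝ} {j : ℕ} {p : ℝ → ℝ}

/-- The commutator symbol vanishes on `ξ = η`; elsewhere neither denominator does, and the
numerator is a second difference. -/
lemma exists_commSymbol_bound (hp : IsSymbol α j p) :
    ∃ C : ℝ, ∀ ξ η σ : ℝ, (ξ, η, σ) ∈ regA2cPos ∩ regB →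
      |commSymbol p ξ η σ| ≤
        C * (|mult p (ξ - η) η / ξ| * |mult p (ξ - η) σ / (ξ - η + σ)|) *
          (|ξ - η| * |σ - η| * η ^ (α - 1)) := by
  obtain ⟨K, hK, h⟩ := hp.exists_resonance_sub_bound
  refine ⟨2 * K, fun ξ η σ hz => ?_⟩
  obtain ⟨hξ, hη, hσ, hs, h1, h2, h3, h4⟩ := bounds_of_mem_region hz
  have e1 : mult p (ξ - η) η / ξ = 1 / (2 * resonance p (ξ - η) η) := by
    have := mult_div_add p (a := ξ - η) (b := η) (by rw [sub_add_cancel]; linarith)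
    rwa [sub_add_cancel] at this
  have e2 := mult_div_add p (a := ξ - η) (b := σ) (by linarith)
  rw [commSymbol, e1, e2]
  -- On `ξ = η` both resonance functions vanish, and division by zero makes both sides 0.
  rcases eq_or_ne (ξ - η) 0 with h0 | h0
  · simp [h0, resonance_zero_left]
  have n0 := abs_nonneg (ξ - η)
  have n1 := abs_nonneg (η - σ)
  have n2 := abs_nonneg (ξ - σ)
  have n3 := abs_nonneg (σ - ξ)
  rw [abs_sub_comm η ξ] at h2
  have d1 := hp.resonance_ne_zero h0 (b := η) (by linarith) (by linarith) hη (by linarith)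
  have d2 := hp.resonance_ne_zero h0 (b := σ) (by linarith) (by linarith) hσ (by linarith)
  have hsub := h (ξ - η) η σ hη (by linarith) (by rw [abs_sub_comm]; linarith)
  set D₁ := resonance p (ξ - η) η
  set D₂ := resonance p (ξ - η) σ
  have e3 : 1 / (2 * D₁) - 1 / (2 * D₂) =
      2 * ((1 / (2 * D₁)) * (1 / (2 * D₂))) * (D₂ - D₁) := by
    field_simp
  rw [e3, abs_mul, abs_mul, abs_mul, abs_two]
  calc _ ≤ 2 * (|1 / (2 * D₁)| * |1 / (2 * D₂)|) * (K * (|ξ - η| * |σ - η| * η ^ (α - 1))) := by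
        gcongr
    _ = _ := by ring

/-- The commutator symbol with the derivative that falls on `u`, and one of the derivatives of
highest order. -/
lemma exists_commSymbol_mul_bound (hp : IsSymbol α j p) :
    ∃ C > 0, ∀ ξ η σ : ℝ, (ξ, η, σ) ∈ regA2cPos ∩ regB →
      |commSymbol p ξ η σ| * |ξ - η| * ξ ≤
        C * (|η - σ| + (1 + (ξ - η) ^ 2) * |η - σ| * ξ⁻¹) := by
  obtain ⟨K, hK, h⟩ := hp.exists_resonance_sub_bound
  obtain ⟨c, hc, hlow⟩ := hp.exists_resonance_lower
  refine ⟨8 * K * c⁻¹, by positivity, fun ξ η σ hz => ?_⟩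
  obtain ⟨hξ, hη, hσ, hs, h1, h2, h3, h4⟩ := bounds_of_mem_region hz
  rw [commSymbol_eq p (by linarith) (by linarith)]
  have hξ0 : 0 < ξ := by linarith
  have hη0 : 0 < η := by linarith
  rcases eq_or_ne (ξ - η) 0 with h0 | h0
  · rw [h0]
    simp only [abs_zero, mul_zero, zero_mul]
    positivity
  have n0 := abs_nonneg (ξ - η)
  have n1 := abs_nonneg (η - σ)
  have n2 := abs_nonneg (ξ - σ)
  have n3 := abs_nonneg (σ - ξ)
  rw [abs_sub_comm η ξ] at h2
  have d1 := hp.resonance_ne_zero h0 (b := η) (by linarith) (by linarith) hη (by linarith)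
  have d2 := hp.resonance_ne_zero h0 (b := σ) (by linarith) (by linarith) hσ (by linarith)
  have l1 := hlow (ξ - η) η η h0 (by linarith) (by linarith) hη (by linarith)
    (by rw [sub_self, abs_zero]; linarith)
  have l2 := hlow (ξ - η) σ η h0 (by linarith) (by linarith) hσ (by linarith)
    (by rw [abs_sub_comm]; linarith)
  have hsub := h (ξ - η) η σ hη (by linarith) (by rw [abs_sub_comm]; linarith)
  have hrat : ξ ≤ 2 * η := by linarith [le_abs_self (ξ - η)]
  have hW : lossWeight (ξ - η) η ≤ 4 * (1 + (1 + (ξ - η) ^ 2) * ξ⁻¹) := by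
    have s1 : (1 + |ξ - η|) ^ 2 ≤ 2 * (1 + (ξ - η) ^ 2) := by
      rw [← sq_abs (ξ - η)]; nlinarith [sq_nonneg (1 - |ξ - η|)]
    have s2 : η⁻¹ ≤ 2 * ξ⁻¹ := by
      rw [← div_eq_mul_inv, le_div_iff₀ hξ0, inv_mul_le_iff₀ hη0]; linarith
    have : (1 + |ξ - η|) ^ 2 / η ≤ 2 * (1 + (ξ - η) ^ 2) * (2 * ξ⁻¹) := by
      rw [div_eq_mul_inv]; gcongr
    unfold lossWeight
    linarith
  set a := ξ - η
  set D₁ := resonance p a η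
  set D₂ := resonance p a σ
  set W := lossWeight a η
  have hηα : 0 < η ^ α := Real.rpow_pos_of_pos hη0 _
  have a0 : 0 < a ^ 2 := by positivity
  have i1 : a ^ 2 * η ^ α / D₁ ^ 2 ≤ c⁻¹ * W := by
    rw [div_le_iff₀ (by positivity), mul_assoc, ← div_eq_inv_mul, le_div_iff₀ hc]; linarith
  have i2 : a ^ 2 * η ^ α / D₂ ^ 2 ≤ c⁻¹ * W := by
    rw [div_le_iff₀ (by positivity), mul_assoc, ← div_eq_inv_mul, le_div_iff₀ hc]; linarith
  -- The inequality between arithmetic and geometric means separates the two denominators, so that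
  -- the lower bounds on `D₁²` and `D₂²` apply without square roots of the weight.
  have i3 : |(1 / D₁) * (1 / D₂)| ≤ 1 / 2 * (1 / D₁ ^ 2 + 1 / D₂ ^ 2) := by
    rw [abs_mul, ← one_div_pow, ← one_div_pow, ← sq_abs (1 / D₁), ← sq_abs (1 / D₂)]
    nlinarith [sq_nonneg (|1 / D₁| - |1 / D₂|)]
  have i4 : a ^ 2 * η ^ α * |(1 / D₁) * (1 / D₂)| ≤ c⁻¹ * W := by
    calc _ ≤ a ^ 2 * η ^ α * (1 / 2 * (1 / D₁ ^ 2 + 1 / D₂ ^ 2)) := by gcongr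
      _ = 1 / 2 * (a ^ 2 * η ^ α / D₁ ^ 2 + a ^ 2 * η ^ α / D₂ ^ 2) := by ring
      _ ≤ _ := by linarith
  have e3 : 1 / (2 * D₁) - 1 / (2 * D₂) = 1 / 2 * ((1 / D₁) * (1 / D₂)) * (D₂ - D₁) := by
    field_simp
  have e4 : η ^ (α - 1) * η = η ^ α := by rw [← Real.rpow_add_one hη0.ne']; ring_nf
  rw [e3, abs_mul, abs_mul, abs_of_pos (by norm_num : (0 : ℝ) < 1 / 2)]
  -- One factor `|a|` comes from the second difference, the other is the derivative on `u`; the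
  -- factor `ξ ≤ 2η` raises `η^(α-1)` to `η^α`. Together they form exactly the `a² η^α` that the
  -- denominators absorb.
  calc 1 / 2 * |(1 / D₁) * (1 / D₂)| * |D₂ - D₁| * |a| * ξ
      ≤ 1 / 2 * |(1 / D₁) * (1 / D₂)| * (K * (|a| * |σ - η| * η ^ (α - 1))) * |a| * (2 * η) := by
        gcongr
    _ = K * |η - σ| * (a ^ 2 * η ^ α * |(1 / D₁) * (1 / D₂)|) := by
        rw [← e4, ← sq_abs a, abs_sub_comm σ η]; ring
    _ ≤ K * |η - σ| * (c⁻¹ * W) := by gcongr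
    _ ≤ K * |η - σ| * (c⁻¹ * (8 * (1 + (1 + a ^ 2) * ξ⁻¹))) := by
        gcongr
        have : 0 ≤ (1 + a ^ 2) * ξ⁻¹ := by positivity
        linarith
    _ = _ := by ring

end IsSymbol

end Whitham

namespace Whitham

/-! ### Convolution forms -/

lemma ennreal_mul_le_sq_add_sq (x y : ℝ≥0∞) : x * y ≤ x ^ 2 + y ^ 2 := by
  rcases le_total x y with h | h
  · calc x * y ≤ y * y := by gcongr
      _ ≤ _ := by rw [← sq]; exact le_add_self
  · calc x * y ≤ x * x := by gcongr
      _ ≤ _ := by rw [← sq]; exact le_self_add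

lemma lintegral_sub_left (f : ℝ → ℝ≥0∞) (x : ℝ) : ∫⁻ y, f (x - y) = ∫⁻ y, f y :=
  lintegral_sub_left_eq_self f x

lemma lintegral_mul_le_sqrt {f g : ℝ → ℝ≥0∞} (hf : Measurable f) (hg : Measurable g) :
    ∫⁻ x, f x * g x ≤ (∫⁻ x, f x ^ 2) ^ (1 / 2 : ℝ) * (∫⁻ x, g x ^ 2) ^ (1 / 2 : ℝ) := by
  have := ENNReal.lintegral_mul_le_Lp_mul_Lq volume (Real.HolderConjugate.two_two)
    hf.aemeasurable hg.aemeasurable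
  simpa using this

/-- Cauchy–Schwarz against `(1+x²)^(-1/2)`, whose square has integral `π`. This turns one extra
derivative in `L²` into an `L¹` bound on the Fourier side. -/
lemma lintegral_le_sqrt_weighted {f : ℝ → ℝ≥0∞} (hf : Measurable f) :
    ∫⁻ x, f x ≤ ENNReal.ofReal Real.pi ^ (1 / 2 : ℝ) *
      (∫⁻ x, ENNReal.ofReal (1 + x ^ 2) * f x ^ 2) ^ (1 / 2 : ℝ) := by
  have hw : ∀ x : ℝ, 0 < 1 + x ^ 2 := fun x => by positivity
  have h1 : ∀ x : ℝ, f x = ENNReal.ofReal (√(1 + x ^ 2))⁻¹ *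
      (ENNReal.ofReal √(1 + x ^ 2) * f x) := by
    intro x
    rw [← mul_assoc, ← ENNReal.ofReal_mul (by positivity),
      inv_mul_cancel₀ (Real.sqrt_pos.2 (hw x)).ne', ENNReal.ofReal_one, one_mul]
  have h2 : ∫⁻ x : ℝ, ENNReal.ofReal (√(1 + x ^ 2))⁻¹ ^ 2 = ENNReal.ofReal Real.pi := by
    rw [← integral_univ_inv_one_add_sq, ofReal_integral_eq_lintegral_ofReal
      integrable_inv_one_add_sq (Eventually.of_forall fun x => (inv_pos.2 (hw x)).le)]
    refine lintegral_congr fun x => ?_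
    rw [← ENNReal.ofReal_pow (by positivity), inv_pow, Real.sq_sqrt (hw x).le]
  calc ∫⁻ x, f x = ∫⁻ x, ENNReal.ofReal (√(1 + x ^ 2))⁻¹ *
      (ENNReal.ofReal √(1 + x ^ 2) * f x) := lintegral_congr h1
    _ ≤ _ := lintegral_mul_le_sqrt (by fun_prop) (by fun_prop)
    _ = _ := by
      rw [h2]
      congr 2
      refine lintegral_congr fun x => ?_
      rw [mul_pow, ← ENNReal.ofReal_pow (by positivity), Real.sq_sqrt (hw x).le]

lemma lintegral_triple {F : ℝ × ℝ × ℝ → ℝ≥0∞} (hF : Measurable F) :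
    ∫⁻ z, F z = ∫⁻ ξ, ∫⁻ η, ∫⁻ σ, F (ξ, η, σ) := by
  rw [Measure.volume_eq_prod, lintegral_prod _ hF.aemeasurable]
  refine lintegral_congr fun ξ => ?_
  rw [Measure.volume_eq_prod, lintegral_prod _ (by fun_prop)]

lemma lintegral_triple_swap {F : ℝ × ℝ × ℝ → ℝ≥0∞} (hF : Measurable F) :
    ∫⁻ z, F z = ∫⁻ ξ, ∫⁻ σ, ∫⁻ η, F (ξ, η, σ) := by
  rw [lintegral_triple hF]
  refine lintegral_congr fun ξ => ?_
  exact lintegral_lintegral_swap (by fun_prop)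

lemma lintegral_triple_rotate {F : ℝ × ℝ × ℝ → ℝ≥0∞} (hF : Measurable F) :
    ∫⁻ z, F z = ∫⁻ σ, ∫⁻ ξ, ∫⁻ η, F (ξ, η, σ) := by
  rw [lintegral_triple_swap hF]
  refine lintegral_lintegral_swap ?_
  have : Measurable fun q : (ℝ × ℝ) × ℝ => F (q.1.1, q.2, q.1.2) := by fun_prop
  exact this.lintegral_prod_right'.aemeasurable

/-- A convolution form is bounded by the `L¹` norms of the kernels. -/
lemma lintegral_convolution_form_le {f g h : ℝ → ℝ≥0∞} (hf : Measurable f) (hg : Measurable g)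
    (hh : Measurable h) :
    ∫⁻ z : ℝ × ℝ × ℝ, f (z.1 - z.2.1) * g (z.2.1 - z.2.2) * (h z.2.2 * h z.1) ≤
      2 * ((∫⁻ x, f x) * (∫⁻ x, g x) * ∫⁻ x, h x ^ 2) := by
  calc _ ≤ ∫⁻ z : ℝ × ℝ × ℝ, (f (z.1 - z.2.1) * g (z.2.1 - z.2.2) * h z.2.2 ^ 2 +
        f (z.1 - z.2.1) * g (z.2.1 - z.2.2) * h z.1 ^ 2) := by
        -- Splitting `h(σ) h(ξ)` into squares leaves `h` in a single variable in each term; the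
        -- other two integrations then act on translates of `f` and `g` only.
        refine lintegral_mono fun z => ?_
        rw [← mul_add]
        gcongr
        exact ennreal_mul_le_sq_add_sq _ _
    _ = (∫⁻ z : ℝ × ℝ × ℝ, f (z.1 - z.2.1) * g (z.2.1 - z.2.2) * h z.2.2 ^ 2) +
        ∫⁻ z : ℝ × ℝ × ℝ, f (z.1 - z.2.1) * g (z.2.1 - z.2.2) * h z.1 ^ 2 :=
        lintegral_add_left (by fun_prop) _
    _ = _ := by
      rw [two_mul]
      congr 1
      · rw [lintegral_triple_rotate (by fun_prop)]
        have (σ : ℝ) : ∫⁻ ξ, ∫⁻ η, f (ξ - η) * g (η - σ) * h σ ^ 2 =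
            ((∫⁻ x, f x) * ∫⁻ x, g x) * h σ ^ 2 := by
          rw [lintegral_lintegral_swap (by fun_prop)]
          have (η : ℝ) : ∫⁻ ξ, f (ξ - η) * g (η - σ) * h σ ^ 2 =
              (∫⁻ x, f x) * h σ ^ 2 * g (η - σ) := by
            simp_rw [mul_assoc]
            rw [lintegral_mul_const _ (by fun_prop), lintegral_sub_right_eq_self f, mul_comm (g _)]
          simp_rw [this]
          rw [lintegral_const_mul _ (by fun_prop), lintegral_sub_right_eq_self g]
          ring
        simp_rw [this]
        rw [lintegral_const_mul _ (by fun_prop)]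
      · rw [lintegral_triple (by fun_prop)]
        have (ξ : ℝ) : ∫⁻ η, ∫⁻ σ, f (ξ - η) * g (η - σ) * h ξ ^ 2 =
            ((∫⁻ x, f x) * ∫⁻ x, g x) * h ξ ^ 2 := by
          have (η : ℝ) : ∫⁻ σ, f (ξ - η) * g (η - σ) * h ξ ^ 2 =
              (∫⁻ x, g x) * h ξ ^ 2 * f (ξ - η) := by
            rw [lintegral_mul_const _ (by fun_prop), lintegral_const_mul _ (by fun_prop),
              lintegral_sub_left]
            ring
          simp_rw [this]
          rw [lintegral_const_mul _ (by fun_prop), lintegral_sub_left]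
          ring
        simp_rw [this]
        rw [lintegral_const_mul _ (by fun_prop)]

/-- The kernel `x⁻¹` on `|x - y| ≤ x`, for `x ≥ 1`. -/
noncomputable def coneKernel (x y : ℝ) : ℝ≥0∞ :=
  (Ici (1 : ℝ)).indicator 1 x * (Icc (0 : ℝ) (2 * x)).indicator (fun _ => ENNReal.ofReal x⁻¹) y

lemma measurable_coneKernel : Measurable fun q : ℝ × ℝ => coneKernel q.1 q.2 := by
  unfold coneKernel
  refine Measurable.mul ?_ ?_
  · exact (measurable_one.indicator measurableSet_Ici).comp measurable_fst
  · have : (fun q : ℝ × ℝ => (Icc (0 : ℝ) (2 * q.1)).indicator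
        (fun _ => ENNReal.ofReal q.1⁻¹) q.2) =
        ({q : ℝ × ℝ | 0 ≤ q.2 ∧ q.2 ≤ 2 * q.1}).indicator (fun q => ENNReal.ofReal q.1⁻¹) := by
      ext q; simp only [indicator, mem_Icc, mem_ofPred_eq]
    rw [this]
    refine Measurable.indicator (by fun_prop) ?_
    exact (measurableSet_le measurable_const measurable_snd).inter
      (measurableSet_le measurable_snd (measurable_fst.const_mul 2))

lemma lintegral_coneKernel_le (x : ℝ) : ∫⁻ y, coneKernel x y ≤ 2 := by
  unfold coneKernel
  rw [lintegral_const_mul _ (by measurability)]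
  by_cases hx : 1 ≤ x
  · rw [lintegral_indicator measurableSet_Icc, setLIntegral_const, Real.volume_Icc,
      ← ENNReal.ofReal_mul (by positivity), sub_zero, indicator_of_mem (mem_Ici.2 hx)]
    have : x⁻¹ * (2 * x) = 2 := by field_simp
    rw [this]; simp
  · rw [indicator_of_notMem (by simpa using hx)]; simp

/-- A convolution form localised to comparable frequencies gains one derivative, and is then
bounded by the `L²` norms of the kernels. -/
lemma lintegral_convolution_cone_le {f g h : ℝ → ℝ≥0∞} (hf : Measurable f) (hg : Measurable g)
    (hh : Measurable h) :
    ∫⁻ z : ℝ × ℝ × ℝ, f (z.1 - z.2.1) * g (z.2.1 - z.2.2) *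
        (coneKernel z.1 z.2.2 * h z.1 ^ 2 + coneKernel z.2.2 z.1 * h z.2.2 ^ 2) ≤
      4 * ((∫⁻ x, f x ^ 2) ^ (1 / 2 : ℝ) * (∫⁻ x, g x ^ 2) ^ (1 / 2 : ℝ) * ∫⁻ x, h x ^ 2) := by
  have hk := measurable_coneKernel
  have hk1 : Measurable fun z : ℝ × ℝ × ℝ => coneKernel z.1 z.2.2 :=
    hk.comp (by fun_prop : Measurable fun z : ℝ × ℝ × ℝ => (z.1, z.2.2))
  have hk2 : Measurable fun z : ℝ × ℝ × ℝ => coneKernel z.2.2 z.1 :=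
    hk.comp (by fun_prop : Measurable fun z : ℝ × ℝ × ℝ => (z.2.2, z.1))
  have hk3 (x : ℝ) : Measurable fun y => coneKernel x y :=
    hk.comp (by fun_prop : Measurable fun y => (x, y))
  set M := (∫⁻ x, f x ^ 2) ^ (1 / 2 : ℝ) * (∫⁻ x, g x ^ 2) ^ (1 / 2 : ℝ)
  -- Cauchy–Schwarz in `η` is uniform in `ξ` and `σ`, which are then coupled only through the cone
  -- kernel, of integral at most 2 in its second variable.
  have hM (ξ σ : ℝ) : ∫⁻ η, f (ξ - η) * g (η - σ) ≤ M := by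
    refine (lintegral_mul_le_sqrt (by fun_prop) (by fun_prop)).trans_eq ?_
    rw [lintegral_sub_left (fun x => f x ^ 2), lintegral_sub_right_eq_self (fun x => g x ^ 2)]
  have outer (K : ℝ → ℝ → ℝ≥0∞) (hK : ∀ x y, K x y ≤ M * (coneKernel x y * h x ^ 2)) :
      ∫⁻ x, ∫⁻ y, K x y ≤ 2 * (M * ∫⁻ x, h x ^ 2) := by
    calc ∫⁻ x, ∫⁻ y, K x y ≤ ∫⁻ x, (2 * M) * h x ^ 2 := by
          refine lintegral_mono fun x => ?_
          calc ∫⁻ y, K x y ≤ ∫⁻ y, (M * h x ^ 2) * coneKernel x y :=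
                lintegral_mono fun y => (hK x y).trans_eq (by ring)
            _ = (M * h x ^ 2) * ∫⁻ y, coneKernel x y := lintegral_const_mul _ (hk3 x)
            _ ≤ (M * h x ^ 2) * 2 := by gcongr; exact lintegral_coneKernel_le x
            _ = _ := by ring
      _ = _ := by rw [lintegral_const_mul _ (by fun_prop), mul_assoc]
  simp_rw [mul_add]
  rw [lintegral_add_left (by fun_prop),
    show (4 : ℝ≥0∞) = 2 + 2 by norm_num, add_mul]
  refine add_le_add ?_ ?_
  · rw [lintegral_triple_swap (by fun_prop)]
    refine outer _ fun ξ σ => ?_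
    dsimp only
    rw [lintegral_mul_const _ (by fun_prop)]
    gcongr
    exact hM ξ σ
  · rw [lintegral_triple_rotate (by fun_prop)]
    refine outer _ fun σ ξ => ?_
    dsimp only
    rw [lintegral_mul_const _ (by fun_prop)]
    gcongr
    exact hM ξ σ

end Whitham

namespace Whitham

/-! ### Sobolev norms, the majorant and the final estimate -/

lemma measurable_uhat (u : Lp ℝ 2 (volume : Measure ℝ)) : Measurable (uhat u) :=
  (Lp.stronglyMeasurable _).measurable.comp (by fun_prop)

lemma normH_nonneg (s : ℕ) (u : Lp ℝ 2 (volume : Measure ℝ)) : 0 ≤ normH s u := Real.sqrt_nonneg _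

lemma MemH.lintegral_eq {s : ℕ} {u : Lp ℝ 2 (volume : Measure ℝ)} (h : MemH s u) :
    ∫⁻ x : ℝ, ENNReal.ofReal ((1 + x ^ 2) ^ s) * ‖uhat u x‖ₑ ^ 2 =
      ENNReal.ofReal (2 * Real.pi * normH s u ^ 2) := by
  have hnn : ∀ x : ℝ, 0 ≤ (1 + x ^ 2) ^ s * ‖uhat u x‖ ^ 2 := fun x => by positivity
  have h1 : 2 * Real.pi * normH s u ^ 2 = ∫ x : ℝ, (1 + x ^ 2) ^ s * ‖uhat u x‖ ^ 2 := by
    rw [normH, Real.sq_sqrt (mul_nonneg (by positivity) (integral_nonneg hnn))]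
    field_simp
  rw [h1, ofReal_integral_eq_lintegral_ofReal h (Eventually.of_forall hnn)]
  refine lintegral_congr fun x => ?_
  rw [ENNReal.ofReal_mul (by positivity), ENNReal.ofReal_pow (norm_nonneg _), ofReal_norm]

lemma MemH.sqrt_lintegral_eq {s : ℕ} {u : Lp ℝ 2 (volume : Measure ℝ)} (h : MemH s u) :
    (∫⁻ x : ℝ, ENNReal.ofReal ((1 + x ^ 2) ^ s) * ‖uhat u x‖ₑ ^ 2) ^ (1 / 2 : ℝ) =
      ENNReal.ofReal (√(2 * Real.pi) * normH s u) := by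
  rw [h.lintegral_eq, ENNReal.ofReal_rpow_of_nonneg (by positivity) (by norm_num),
    ← Real.sqrt_eq_rpow, Real.sqrt_mul (by positivity), Real.sqrt_sq (normH_nonneg s u)]

lemma MemH.mono {s t : ℕ} (hst : s ≤ t) {u : Lp ℝ 2 (volume : Measure ℝ)} (h : MemH t u) :
    MemH s u := by
  refine Integrable.mono' h ?_ (Eventually.of_forall fun x => ?_)
  · have := measurable_uhat u
    exact (by fun_prop : Measurable fun ξ : ℝ =>
      (1 + ξ ^ 2) ^ s * ‖uhat u ξ‖ ^ 2).aestronglyMeasurable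
  · rw [Real.norm_of_nonneg (by positivity)]
    gcongr
    nlinarith [sq_nonneg x]

lemma lintegral_enorm_uhat_le {u : Lp ℝ 2 (volume : Measure ℝ)} (h : MemH 1 u) :
    ∫⁻ x, ‖uhat u x‖ₑ ≤
      ENNReal.ofReal Real.pi ^ (1 / 2 : ℝ) * ENNReal.ofReal (√(2 * Real.pi) * normH 1 u) := by
  have := measurable_uhat u
  refine (lintegral_le_sqrt_weighted (by fun_prop)).trans_eq ?_
  rw [← h.sqrt_lintegral_eq]
  simp only [pow_one]

lemma lintegral_mul_enorm_uhat_le {u : Lp ℝ 2 (volume : Measure ℝ)} (h : MemH 2 u) :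
    ∫⁻ x, ENNReal.ofReal |x| * ‖uhat u x‖ₑ ≤
      ENNReal.ofReal Real.pi ^ (1 / 2 : ℝ) * ENNReal.ofReal (√(2 * Real.pi) * normH 2 u) := by
  have := measurable_uhat u
  refine (lintegral_le_sqrt_weighted (by fun_prop)).trans ?_
  rw [← h.sqrt_lintegral_eq]
  refine mul_le_mul' le_rfl (ENNReal.rpow_le_rpow (lintegral_mono fun x => ?_) (by norm_num))
  rw [mul_pow, ← mul_assoc, ← ENNReal.ofReal_pow (abs_nonneg _),
    ← ENNReal.ofReal_mul (by positivity)]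
  gcongr
  rw [sq_abs]
  nlinarith [sq_nonneg x]

lemma sqrt_lintegral_sq_mul_enorm_uhat_le {u : Lp ℝ 2 (volume : Measure ℝ)} (h : MemH 1 u) :
    (∫⁻ x, (ENNReal.ofReal |x| * ‖uhat u x‖ₑ) ^ 2) ^ (1 / 2 : ℝ) ≤
      ENNReal.ofReal (√(2 * Real.pi) * normH 1 u) := by
  rw [← h.sqrt_lintegral_eq]
  gcongr with x
  rw [mul_pow, ← ENNReal.ofReal_pow (abs_nonneg _)]
  gcongr
  rw [sq_abs]
  nlinarith [sq_nonneg x]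

lemma sqrt_lintegral_sq_weight_mul_enorm_uhat {u : Lp ℝ 2 (volume : Measure ℝ)} (h : MemH 2 u) :
    (∫⁻ x, (ENNReal.ofReal (1 + x ^ 2) * ‖uhat u x‖ₑ) ^ 2) ^ (1 / 2 : ℝ) =
      ENNReal.ofReal (√(2 * Real.pi) * normH 2 u) := by
  rw [← h.sqrt_lintegral_eq]
  congr 2 with x
  rw [mul_pow, ← ENNReal.ofReal_pow (by positivity)]

lemma lintegral_sq_pow_mul_enorm_uhat_le {k : ℕ} {u : Lp ℝ 2 (volume : Measure ℝ)}
    (h : MemH k u) :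
    ∫⁻ x, (ENNReal.ofReal (|x| ^ k) * ‖uhat u x‖ₑ) ^ 2 ≤
      ENNReal.ofReal (2 * Real.pi * normH k u ^ 2) := by
  rw [← h.lintegral_eq]
  gcongr with x
  rw [mul_pow, ← ENNReal.ofReal_pow (by positivity), ← pow_mul, mul_comm k 2, pow_mul, sq_abs]
  gcongr
  linarith

lemma measurable_commIntegrand {p : ℝ → ℝ} (hp : Measurable p) (k : ℕ)
    (u : Lp ℝ 2 (volume : Measure ℝ)) : Measurable (commIntegrand p k u) := by
  have := measurable_uhat u
  have hc : Measurable (starRingEnd ℂ) := Complex.continuous_conj.measurable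
  unfold commIntegrand quarticDensity commSymbol mult
  fun_prop

/-- Each square is paired with the kernel based at its own frequency, so that the other frequency
can be integrated out; `ξ⁻¹` may be exchanged for `σ⁻¹` because the two are comparable. -/
lemma ofReal_inv_mul_le_coneKernel {ξ σ : ℝ} (hξ : 1 ≤ ξ) (hσ : 1 ≤ σ) (h1 : ξ ≤ 2 * σ)
    (h2 : σ ≤ 2 * ξ) (a b : ℝ≥0∞) :
    ENNReal.ofReal ξ⁻¹ * (a * b) ≤ 2 * (coneKernel ξ σ * b ^ 2 + coneKernel σ ξ * a ^ 2) := by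
  have e1 : coneKernel ξ σ = ENNReal.ofReal ξ⁻¹ := by
    rw [coneKernel, indicator_of_mem (mem_Ici.2 hξ),
      indicator_of_mem (mem_Icc.2 ⟨by linarith, h2⟩)]
    simp
  have e2 : coneKernel σ ξ = ENNReal.ofReal σ⁻¹ := by
    rw [coneKernel, indicator_of_mem (mem_Ici.2 hσ),
      indicator_of_mem (mem_Icc.2 ⟨by linarith, h1⟩)]
    simp
  have e3 : ENNReal.ofReal ξ⁻¹ ≤ 2 * ENNReal.ofReal σ⁻¹ := by
    rw [← ENNReal.ofReal_ofNat, ← ENNReal.ofReal_mul (by norm_num)]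
    gcongr
    rw [← div_eq_mul_inv, le_div_iff₀ (by linarith), inv_mul_le_iff₀ (by linarith)]
    linarith
  rw [e1, e2]
  calc _ ≤ ENNReal.ofReal ξ⁻¹ * (a ^ 2 + b ^ 2) := by gcongr; exact ennreal_mul_le_sq_add_sq a b
    _ = ENNReal.ofReal ξ⁻¹ * b ^ 2 + ENNReal.ofReal ξ⁻¹ * a ^ 2 := by ring
    _ ≤ 2 * (ENNReal.ofReal ξ⁻¹ * b ^ 2) + 2 * ENNReal.ofReal σ⁻¹ * a ^ 2 := by
        refine add_le_add ?_ (mul_le_mul' e3 le_rfl)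
        rw [two_mul]
        exact le_self_add
    _ = _ := by ring

/-- The majorant of the commutator integrand. -/
noncomputable def commMajorant (k : ℕ) (u : Lp ℝ 2 (volume : Measure ℝ)) (z : ℝ × ℝ × ℝ) : ℝ≥0∞ :=
  let w : ℝ → ℝ≥0∞ := fun x => ‖uhat u x‖ₑ
  let v : ℝ → ℝ≥0∞ := fun x => ENNReal.ofReal |x| * ‖uhat u x‖ₑ
  let W : ℝ → ℝ≥0∞ := fun x => ENNReal.ofReal (1 + x ^ 2) * ‖uhat u x‖ₑ
  let h : ℝ → ℝ≥0∞ := fun x => ENNReal.ofReal (|x| ^ k) * ‖uhat u x‖ₑ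
  w (z.1 - z.2.1) * v (z.2.1 - z.2.2) * (h z.2.2 * h z.1) +
    2 * (W (z.1 - z.2.1) * v (z.2.1 - z.2.2) *
      (coneKernel z.1 z.2.2 * h z.1 ^ 2 + coneKernel z.2.2 z.1 * h z.2.2 ^ 2))

lemma measurable_commMajorant (k : ℕ) (u : Lp ℝ 2 (volume : Measure ℝ)) :
    Measurable (commMajorant k u) := by
  have := measurable_uhat u
  have hk1 : Measurable fun z : ℝ × ℝ × ℝ => coneKernel z.1 z.2.2 :=
    measurable_coneKernel.comp (by fun_prop : Measurable fun z : ℝ × ℝ × ℝ => (z.1, z.2.2))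
  have hk2 : Measurable fun z : ℝ × ℝ × ℝ => coneKernel z.2.2 z.1 :=
    measurable_coneKernel.comp (by fun_prop : Measurable fun z : ℝ × ℝ × ℝ => (z.2.2, z.1))
  unfold commMajorant
  fun_prop

lemma exists_lintegral_commMajorant_le :
    ∃ C > 0, ∀ (k : ℕ) (u : Lp ℝ 2 (volume : Measure ℝ)), MemH 2 u → MemH k u →
      ∫⁻ z, commMajorant k u z ≤
        ENNReal.ofReal (C * (normH 1 u * normH 2 u * normH k u ^ 2)) := by
  have hπ := Real.pi_pos
  -- The summand `2π` is the 2 of the `L¹` form times `√π √π` from the two `L¹` bounds; the 8 is `2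
  -- · 4` from the cone form. The factor `(2π)²` is the normalisation of the Fourier transform:
  -- `√(2π)` from each of `H¹` and `H²`, and `2π` from the square of `H^k`.
  refine ⟨(2 * Real.pi + 8) * (2 * Real.pi) ^ 2, by positivity, fun k u h2 hk => ?_⟩
  have h1 : MemH 1 u := h2.mono one_le_two
  have hm := measurable_uhat u
  have n1 := normH_nonneg 1 u
  have n2 := normH_nonneg 2 u
  have hs : ∀ x y : ℝ, √(2 * Real.pi) * x * (√(2 * Real.pi) * y) = 2 * Real.pi * (x * y) := by
    intro x y
    rw [mul_mul_mul_comm, Real.mul_self_sqrt (by positivity)]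
  have hr : ENNReal.ofReal Real.pi ^ (1 / 2 : ℝ) * ENNReal.ofReal Real.pi ^ (1 / 2 : ℝ) =
      ENNReal.ofReal Real.pi := by
    rw [← ENNReal.rpow_add_of_nonneg _ _ (by norm_num) (by norm_num)]; norm_num
  have A := lintegral_convolution_form_le (f := fun x => ‖uhat u x‖ₑ)
    (g := fun x => ENNReal.ofReal |x| * ‖uhat u x‖ₑ)
    (h := fun x => ENNReal.ofReal (|x| ^ k) * ‖uhat u x‖ₑ) (by fun_prop) (by fun_prop)
    (by fun_prop)
  have B := lintegral_convolution_cone_le (f := fun x => ENNReal.ofReal (1 + x ^ 2) * ‖uhat u x‖ₑ)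
    (g := fun x => ENNReal.ofReal |x| * ‖uhat u x‖ₑ)
    (h := fun x => ENNReal.ofReal (|x| ^ k) * ‖uhat u x‖ₑ) (by fun_prop) (by fun_prop)
    (by fun_prop)
  have hk1 : Measurable fun z : ℝ × ℝ × ℝ => coneKernel z.1 z.2.2 :=
    measurable_coneKernel.comp (by fun_prop : Measurable fun z : ℝ × ℝ × ℝ => (z.1, z.2.2))
  have hk2 : Measurable fun z : ℝ × ℝ × ℝ => coneKernel z.2.2 z.1 :=
    measurable_coneKernel.comp (by fun_prop : Measurable fun z : ℝ × ℝ × ℝ => (z.2.2, z.1))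
  simp only [commMajorant]
  rw [lintegral_add_left (by fun_prop), lintegral_const_mul _ (by fun_prop)]
  calc _ ≤ 2 * ((ENNReal.ofReal Real.pi ^ (1 / 2 : ℝ) *
            ENNReal.ofReal (√(2 * Real.pi) * normH 1 u)) *
          (ENNReal.ofReal Real.pi ^ (1 / 2 : ℝ) * ENNReal.ofReal (√(2 * Real.pi) * normH 2 u)) *
          ENNReal.ofReal (2 * Real.pi * normH k u ^ 2)) +
        2 * (4 * (ENNReal.ofReal (√(2 * Real.pi) * normH 2 u) *
          ENNReal.ofReal (√(2 * Real.pi) * normH 1 u) *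
          ENNReal.ofReal (2 * Real.pi * normH k u ^ 2))) := by
        refine add_le_add (A.trans ?_) (mul_le_mul_right (B.trans ?_) 2)
        · gcongr
          · exact lintegral_enorm_uhat_le h1
          · exact lintegral_mul_enorm_uhat_le h2
          · exact lintegral_sq_pow_mul_enorm_uhat_le hk
        · gcongr
          · exact (sqrt_lintegral_sq_weight_mul_enorm_uhat h2).le
          · exact sqrt_lintegral_sq_mul_enorm_uhat_le h1
          · exact lintegral_sq_pow_mul_enorm_uhat_le hk
    _ = (2 * ENNReal.ofReal Real.pi + 8) * (ENNReal.ofReal (√(2 * Real.pi) * normH 1 u) *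
          ENNReal.ofReal (√(2 * Real.pi) * normH 2 u) *
          ENNReal.ofReal (2 * Real.pi * normH k u ^ 2)) := by
        generalize ENNReal.ofReal Real.pi = P at hr ⊢
        generalize P ^ (1 / 2 : ℝ) = Q at hr ⊢
        rw [← hr]; ring
    _ = _ := by
        rw [← ENNReal.ofReal_mul (by positivity), ← ENNReal.ofReal_mul (by positivity),
          ← ENNReal.ofReal_ofNat 2, ← ENNReal.ofReal_ofNat 8, ← ENNReal.ofReal_mul (by positivity),
          ← ENNReal.ofReal_add (by positivity) (by positivity),
          ← ENNReal.ofReal_mul (by positivity), hs]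
        congr 1
        ring

lemma IsSymbol.exists_enorm_commIntegrand_le {α : ℝ} {j : ℕ} {p : ℝ → ℝ} (hp : IsSymbol α j p) :
    ∃ C > 0, ∀ (k : ℕ) (u : Lp ℝ 2 (volume : Measure ℝ)), ∀ z ∈ regA2cPos ∩ regB,
      ‖commIntegrand p k u z‖ₑ ≤ ENNReal.ofReal C * commMajorant k u z := by
  obtain ⟨C, hC, h⟩ := hp.exists_commSymbol_mul_bound
  refine ⟨C, hC, fun k u ⟨ξ, η, σ⟩ hz => ?_⟩
  obtain ⟨hξ, hη, hσ, -, h1, h2, h3, -⟩ := bounds_of_mem_region hz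
  have hN := h ξ η σ hz
  have hξ0 : 0 < ξ := by linarith
  have hσ0 : 0 < σ := by linarith
  have n0 := abs_nonneg (ξ - η)
  have n1 := abs_nonneg (η - ξ)
  have hrat1 : ξ ≤ 2 * σ := by linarith [neg_abs_le (σ - ξ)]
  have hrat2 : σ ≤ 2 * ξ := by linarith [neg_abs_le (ξ - σ)]
  -- Of the `k + 1` powers of `ξ`, one is spent on the symbol and `k` stay with `û(ξ)`.
  have e1 : ‖((-commSymbol p ξ η σ * (ξ - η) * σ ^ k * ξ ^ (k + 1) : ℝ) : ℂ)‖ₑ =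
      ENNReal.ofReal (|commSymbol p ξ η σ| * |ξ - η| * ξ) *
        (ENNReal.ofReal (|σ| ^ k) * ENNReal.ofReal (|ξ| ^ k)) := by
    rw [← ENNReal.ofReal_mul (by positivity), ← ENNReal.ofReal_mul (by positivity),
      ← ofReal_norm, Complex.norm_real, Real.norm_eq_abs]
    congr 1
    simp only [abs_mul, abs_neg, abs_pow, abs_of_pos hξ0]
    ring
  have e2 : ENNReal.ofReal (C * (|η - σ| + (1 + (ξ - η) ^ 2) * |η - σ| * ξ⁻¹)) =
      ENNReal.ofReal C * (ENNReal.ofReal |η - σ| + ENNReal.ofReal (1 + (ξ - η) ^ 2) *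
        ENNReal.ofReal |η - σ| * ENNReal.ofReal ξ⁻¹) := by
    rw [ENNReal.ofReal_mul hC.le, ENNReal.ofReal_add (by positivity) (by positivity),
      ENNReal.ofReal_mul (by positivity), ENNReal.ofReal_mul (by positivity)]
  have e3 : ‖starRingEnd ℂ (uhat u ξ)‖ₑ = ‖uhat u ξ‖ₑ := by
    rw [← ofReal_norm, ← ofReal_norm, RCLike.norm_conj]
  have hcone := ofReal_inv_mul_le_coneKernel hξ hσ hrat1 hrat2
    (ENNReal.ofReal (|σ| ^ k) * ‖uhat u σ‖ₑ) (ENNReal.ofReal (|ξ| ^ k) * ‖uhat u ξ‖ₑ)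
  simp only [commIntegrand, quarticDensity, commMajorant, enorm_mul, e1, e3]
  calc _ ≤ ENNReal.ofReal (C * (|η - σ| + (1 + (ξ - η) ^ 2) * |η - σ| * ξ⁻¹)) *
        (ENNReal.ofReal (|σ| ^ k) * ENNReal.ofReal (|ξ| ^ k)) *
        (‖uhat u (ξ - η)‖ₑ * ‖uhat u (η - σ)‖ₑ * ‖uhat u σ‖ₑ * ‖uhat u ξ‖ₑ) := by gcongr
    _ = ENNReal.ofReal C * (‖uhat u (ξ - η)‖ₑ * (ENNReal.ofReal |η - σ| * ‖uhat u (η - σ)‖ₑ) *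
          ((ENNReal.ofReal (|σ| ^ k) * ‖uhat u σ‖ₑ) * (ENNReal.ofReal (|ξ| ^ k) * ‖uhat u ξ‖ₑ)) +
        (ENNReal.ofReal (1 + (ξ - η) ^ 2) * ‖uhat u (ξ - η)‖ₑ) *
          (ENNReal.ofReal |η - σ| * ‖uhat u (η - σ)‖ₑ) * (ENNReal.ofReal ξ⁻¹ *
          ((ENNReal.ofReal (|σ| ^ k) * ‖uhat u σ‖ₑ) *
            (ENNReal.ofReal (|ξ| ^ k) * ‖uhat u ξ‖ₑ)))) := by
        rw [e2]; ring
    _ ≤ _ := by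
        rw [mul_left_comm 2]
        gcongr

lemma IsSymbol.exists_mainCommutator_bound {α : ℝ} {j : ℕ} {p : ℝ → ℝ} (hp : IsSymbol α j p) :
    ∃ C : ℝ, ∀ (k : ℕ) (u : Lp ℝ 2 (volume : Measure ℝ)), MemH 2 u → MemH k u →
      IntegrableOn (commIntegrand p k u) (regA2cPos ∩ regB) ∧
      ‖mainCommutator p k u‖ ≤ C * (normH 1 u * normH 2 u * normH k u ^ 2) := by
  obtain ⟨C₁, hC₁, h₁⟩ := hp.exists_enorm_commIntegrand_le
  obtain ⟨C₂, hC₂, h₂⟩ := exists_lintegral_commMajorant_le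
  refine ⟨C₁ * C₂, fun k u hu2 huk => ?_⟩
  have n1 := normH_nonneg 1 u
  have n2 := normH_nonneg 2 u
  have hM := measurable_commMajorant k u
  have key : ∫⁻ z in regA2cPos ∩ regB, ‖commIntegrand p k u z‖ₑ ≤
      ENNReal.ofReal (C₁ * C₂ * (normH 1 u * normH 2 u * normH k u ^ 2)) := by
    calc _ ≤ ∫⁻ z in regA2cPos ∩ regB, ENNReal.ofReal C₁ * commMajorant k u z :=
          setLIntegral_mono (by fun_prop) (h₁ k u)
      _ ≤ ∫⁻ z, ENNReal.ofReal C₁ * commMajorant k u z := setLIntegral_le_lintegral _ _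
      _ = ENNReal.ofReal C₁ * ∫⁻ z, commMajorant k u z := lintegral_const_mul _ hM
      _ ≤ ENNReal.ofReal C₁ * ENNReal.ofReal (C₂ * (normH 1 u * normH 2 u * normH k u ^ 2)) := by
          gcongr; exact h₂ k u hu2 huk
      _ = _ := by rw [← ENNReal.ofReal_mul hC₁.le, mul_assoc C₁]
  refine ⟨⟨(measurable_commIntegrand hp.contDiff.continuous.measurable k u).aestronglyMeasurable,
    key.trans_lt ENNReal.ofReal_lt_top⟩, ?_⟩
  rw [mainCommutator, norm_mul, Complex.norm_I, one_mul, ← toReal_enorm]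
  exact ENNReal.toReal_le_of_le_ofReal (by positivity)
    ((enorm_integral_le_lintegral_enorm _).trans key)

end Whitham

theorem mainTheorem6 (α : ℝ) (j k : ℕ) (p : ℝ → ℝ) (hp : Whitham.IsSymbol α j p)
    (hk : 2 * j - 1 ≤ k) :
    (∃ C : ℝ, ∀ ξ η σ : ℝ, (ξ, η, σ) ∈ Whitham.regA2cPos ∩ Whitham.regB →
      |Whitham.commSymbol p ξ η σ| ≤
        C * (|Whitham.mult p (ξ - η) η / ξ| * |Whitham.mult p (ξ - η) σ / (ξ - η + σ)|) *
          (|ξ - η| * |σ - η| * η ^ (α - 1))) ∧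
    ∃ C : ℝ, ∀ u : MeasureTheory.Lp ℝ 2 (MeasureTheory.volume : MeasureTheory.Measure ℝ),
      Whitham.MemH 2 u → Whitham.MemH k u →
        MeasureTheory.IntegrableOn (Whitham.commIntegrand p k u)
          (Whitham.regA2cPos ∩ Whitham.regB) ∧
        ‖Whitham.mainCommutator p k u‖ ≤
          C * (Whitham.normH 1 u * Whitham.normH 2 u * Whitham.normH k u ^ 2) := by
  obtain ⟨C, hC⟩ := hp.exists_mainCommutator_bound
  exact ⟨hp.exists_commSymbol_bound, C, hC k⟩
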